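/- Let $G$ be the Barnes $G$-function (the reciprocal of the double gamma function), given for real $t$ by $$G(1+t)=(2\pi)^{t/2}\exp\!\Big[-\tfrac12(\gamma t^2+t^2+t)\Big]\prod_{k=1}^{\infty}\Big\{\Big(1+\frac tk\Big)^k\exp\Big(\frac{t^2}{2k}-t\Big)\Big\},$$ where $\gamma$ is Euler's constant. Let $B_2(t)=t^2-t+\tfrac16$ be the second Bernoulli polynomial and $\zeta$ the Riemann zeta function. For every real $t$ with $0\le t\le 1$, the product above converges and $G(1+t)>0$, the three series below converge absolutely, and $$\log G(1+t)=-\frac1{4\pi}\sum_{n=1}^{\infty}\frac{\sin 2n\pi t}{n^2}+\frac1{2\pi^2}\Big(\log(2\pi)+\gamma-\frac32\Big)\sum_{n=1}^{\infty}\frac{\cos 2n\pi t}{n^2}+\frac1{2\pi^2}\sum_{n=1}^{\infty}\frac{\cos 2n\pi t\,\log n}{n^2}+t\log\Gamma(t)+\frac14B_2(t)+\zeta'(-1),$$ where for $t=0$ the term $t\log\Gamma(t)$ is read as its limit $\lim_{t\to0^+}t\log\Gamma(t)=0$. -/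

import Mathlib

/-- The `k`-th factor `(1 + t/k)^k * exp (t^2/(2k) - t)`, `k ≥ 1`, of the Weierstrass product of the
Barnes `G`-function at the real point `1 + t`. -/
noncomputable def barnesGFactor (t : ℝ) (k : ℕ) : ℝ :=
  (1 + t / k) ^ k * Real.exp (t ^ 2 / (2 * k) - t)

/-- The Barnes `G`-function on the real line (the reciprocal of the double gamma function), by its
Weierstrass product: with `t = x - 1`,
`G(1 + t) = (2π)^(t/2) exp (-(γ t^2 + t^2 + t)/2) ∏_{k ≥ 1} (1 + t/k)^k exp (t^2/(2k) - t)`. -/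
noncomputable def barnesG (x : ℝ) : ℝ :=
  (2 * Real.pi) ^ ((x - 1) / 2) *
    Real.exp (-(1 / 2) *
      (Real.eulerMascheroniConstant * (x - 1) ^ 2 + (x - 1) ^ 2 + (x - 1))) *
    ∏' k : ℕ, barnesGFactor (x - 1) (k + 1)

open Complex HurwitzZeta Filter Topology

/-! The bridge is `log G(1+t) = t log Γ(t) - ζ'(-1,t) + ζ'(-1)`
(`log_barnesG_eq_deriv_hurwitzZeta`), with `ζ(s,t)` the Hurwitz zeta function. Summed over `κ ≥ 1`,
the second order Taylor remainders of `(κ+t)^(-s)` converge normally around `s = -1` and continue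
the Dirichlet series of `ζ(s,t)` there. Their termwise derivative at `-1` gives the logarithms of
the Weierstrass factors, up to `t` times the series for `log Γ(t)`.

Differentiating Hurwitz's formula (`deriv_hurwitzZeta_neg_one`) turns `ζ'(-1,t)` into the three
trigonometric series. -/

/-! ### The trigonometric Dirichlet series at `s = 2`. -/

lemma abscissaOfAbsConv_cos_le_one (t : ℝ) :
    LSeries.abscissaOfAbsConv (fun n : ℕ => ((Real.cos (2 * Real.pi * t * n) : ℝ) : ℂ)) ≤ 1 := by
  refine LSeries.abscissaOfAbsConv_le_of_forall_lt_LSeriesSummable' fun y hy => ?_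
  have hy' : (1 : ℝ) < y := by exact_mod_cast hy
  exact (LSeriesHasSum_cos t (s := (y : ℂ)) (by simpa using hy')).LSeriesSummable

lemma one_lt_two_EReal_re : (1 : EReal) < ((2 : ℂ).re : EReal) := by
  simp only [re_ofNat]
  exact_mod_cast (one_lt_two : (1 : ℝ) < 2)

/-- The point `2` lies inside the half-plane of absolute convergence, so the series may be
differentiated termwise. -/
lemma hasDerivAt_cosZeta_two (t : ℝ) :
    HasDerivAt (cosZeta t)
      (-LSeries (LSeries.logMul fun n : ℕ => ((Real.cos (2 * Real.pi * t * n) : ℝ) : ℂ)) 2) 2 := by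
  have h := LSeries_hasDerivAt ((abscissaOfAbsConv_cos_le_one t).trans_lt one_lt_two_EReal_re)
  refine h.congr_of_eventuallyEq ?_
  filter_upwards [(isOpen_lt continuous_const continuous_re).mem_nhds
    (show (1 : ℝ) < (2 : ℂ).re by simp)] with s hs
  exact (LSeriesHasSum_cos t hs).LSeries_eq.symm

lemma LSeriesSummable_logMul_cos_two (t : ℝ) :
    LSeriesSummable
      (LSeries.logMul fun n : ℕ => ((Real.cos (2 * Real.pi * t * n) : ℝ) : ℂ)) 2 :=
  LSeriesSummable_logMul_of_lt_re
    ((abscissaOfAbsConv_cos_le_one t).trans_lt one_lt_two_EReal_re)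

lemma hasSum_log_mul_cos_div_sq (t : ℝ) :
    HasSum (fun n : ℕ => ((Real.cos (2 * (n + 1 : ℝ) * Real.pi * t) * Real.log (n + 1 : ℝ) /
        (n + 1 : ℝ) ^ 2 : ℝ) : ℂ)) (-deriv (cosZeta t) 2) := by
  rw [(hasDerivAt_cosZeta_two t).deriv, neg_neg]
  have h := (LSeriesSummable_logMul_cos_two t).LSeriesHasSum
  rw [LSeriesHasSum, ← hasSum_nat_add_iff' 1] at h
  simp only [Finset.range_one, Finset.sum_singleton, LSeries.term_zero, sub_zero] at h
  refine h.congr_fun fun n => ?_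
  rw [LSeries.term_of_ne_zero n.succ_ne_zero, LSeries.logMul]
  have e : Complex.log ((n + 1 : ℕ) : ℂ) = ((Real.log (n + 1 : ℝ) : ℝ) : ℂ) := by
    rw [Complex.ofReal_log (by positivity)]; push_cast; rfl
  rw [e, show 2 * Real.pi * t * ((n + 1 : ℕ) : ℝ) = 2 * (n + 1 : ℝ) * Real.pi * t by
    push_cast; ring]
  push_cast
  norm_cast
  push_cast
  ring

lemma hasSum_cos_div_sq (t : ℝ) :
    HasSum (fun n : ℕ => ((Real.cos (2 * (n + 1 : ℝ) * Real.pi * t) / (n + 1 : ℝ) ^ 2 : ℝ) : ℂ))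
      (cosZeta t 2) := by
  have h := hasSum_nat_cosZeta t (s := 2) (by simp)
  rw [← hasSum_nat_add_iff' 1] at h
  simp only [Finset.range_one, Finset.sum_singleton, Nat.cast_zero, cpow_ofNat, ne_eq,
    OfNat.ofNat_ne_zero, not_false_eq_true, zero_pow, div_zero, sub_zero] at h
  refine h.congr_fun fun n => ?_
  rw [show 2 * Real.pi * t * ((n + 1 : ℕ) : ℝ) = 2 * (n + 1 : ℝ) * Real.pi * t by
    push_cast; ring]
  push_cast
  rfl

lemma hasSum_sin_div_sq (t : ℝ) :
    HasSum (fun n : ℕ => ((Real.sin (2 * (n + 1 : ℝ) * Real.pi * t) / (n + 1 : ℝ) ^ 2 : ℝ) : ℂ))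
      (sinZeta t 2) := by
  have h := hasSum_nat_sinZeta t (s := 2) (by simp)
  rw [← hasSum_nat_add_iff' 1] at h
  simp only [Finset.range_one, Finset.sum_singleton, Nat.cast_zero, cpow_ofNat, ne_eq,
    OfNat.ofNat_ne_zero, not_false_eq_true, zero_pow, div_zero, sub_zero] at h
  refine h.congr_fun fun n => ?_
  rw [show 2 * Real.pi * t * ((n + 1 : ℕ) : ℝ) = 2 * (n + 1 : ℝ) * Real.pi * t by
    push_cast; ring]
  push_cast
  rfl

/-! ### Hurwitz's formula and its derivative. -/

lemma hasDerivAt_Gamma_two :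
    HasDerivAt Complex.Gamma (1 - Real.eulerMascheroniConstant : ℂ) 2 := by
  have h := Complex.hasDerivAt_Gamma_nat 1
  norm_num [harmonic] at h
  convert h using 1
  ring

lemma hurwitzZeta_one_sub_eq_cosZeta_sinZeta (a : UnitAddCircle) {s : ℂ}
    (hs : ∀ n : ℕ, s ≠ -n) (hs' : a ≠ 0 ∨ s ≠ 1) :
    hurwitzZeta a (1 - s) = 2 * (2 * Real.pi) ^ (-s) * Complex.Gamma s *
      (cos (Real.pi * s / 2) * cosZeta a s + sin (Real.pi * s / 2) * sinZeta a s) := by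
  rw [hurwitzZeta, hurwitzZetaEven_one_sub a hs hs', hurwitzZetaOdd_one_sub a hs]
  ring

/-- The derivative at `s = 2` of Hurwitz's formula. -/
theorem deriv_hurwitzZeta_neg_one (t : ℝ) :
    deriv (hurwitzZeta t) (-1) = 1 / (4 * Real.pi) * sinZeta t 2
      - 1 / (2 * Real.pi ^ 2) *
        (Real.log (2 * Real.pi) + Real.eulerMascheroniConstant - 1) * cosZeta t 2
      + 1 / (2 * Real.pi ^ 2) * deriv (cosZeta t) 2 := by
  have hpi : (Real.pi : ℂ) ≠ 0 := by exact_mod_cast Real.pi_ne_zero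
  have h1 : HasDerivAt (fun s => hurwitzZeta t (1 - s)) (deriv (hurwitzZeta t) (-1) * (-1)) 2 := by
    have h0 : HasDerivAt (hurwitzZeta t) (deriv (hurwitzZeta t) (-1)) (1 - 2) := by
      rw [show (1 - 2 : ℂ) = -1 by norm_num]
      exact (differentiableAt_hurwitzZeta _ (by norm_num)).hasDerivAt
    exact h0.comp 2 ((hasDerivAt_id (2 : ℂ)).const_sub 1)
  have hpow : HasDerivAt (fun s : ℂ => (2 * Real.pi : ℂ) ^ (-s))
      ((2 * Real.pi : ℂ) ^ (-2 : ℂ) * Complex.log (2 * Real.pi) * (-1)) 2 :=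
    (hasDerivAt_neg (2 : ℂ)).const_cpow (Or.inl (by simp [hpi]))
  have harg : HasDerivAt (fun s : ℂ => Real.pi * s / 2) (Real.pi / 2 : ℂ) 2 := by
    simpa using ((hasDerivAt_id (2 : ℂ)).const_mul (Real.pi : ℂ)).div_const 2
  have hC := (hasDerivAt_cosZeta_two t).differentiableAt.hasDerivAt
  have hS := (differentiableAt_sinZeta (t : UnitAddCircle) 2).hasDerivAt
  have h2 := ((hpow.const_mul 2).mul hasDerivAt_Gamma_two).mul
    ((harg.ccos.mul hC).add (harg.csin.mul hS))
  have heq : (fun s => hurwitzZeta t (1 - s)) =ᶠ[𝓝 2] fun s : ℂ =>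
      2 * (2 * Real.pi) ^ (-s) * Complex.Gamma s *
      (cos (Real.pi * s / 2) * cosZeta t s + sin (Real.pi * s / 2) * sinZeta t s) := by
    filter_upwards [(isOpen_lt continuous_const continuous_re).mem_nhds
      (show (1 : ℝ) < (2 : ℂ).re by simp)] with s hs
    refine hurwitzZeta_one_sub_eq_cosZeta_sinZeta _ (fun n hn => ?_) (Or.inr fun h => ?_)
    · have : (1 : ℝ) < s.re := hs
      rw [hn] at this
      simp at this
      linarith [(Nat.cast_nonneg n : (0 : ℝ) ≤ n)]
    · have : (1 : ℝ) < s.re := hs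
      simp [h] at this
  have h3 := h1.unique (h2.congr_of_eventuallyEq heq)
  have e1 : (2 * Real.pi : ℂ) ^ (-2 : ℂ) = 1 / (4 * Real.pi ^ 2) := by
    rw [cpow_neg, cpow_ofNat]; field_simp; norm_num
  have e2 : Complex.log (2 * Real.pi) = (Real.log (2 * Real.pi) : ℝ) := by
    rw [Complex.ofReal_log (by positivity)]; push_cast; rfl
  have e3 : Complex.Gamma 2 = 1 := by simp
  have e4 : (Real.pi * 2 / 2 : ℂ) = Real.pi := by ring
  -- Since `sin π = 0`, the derivative of `sinZeta` drops out; `sinZeta t 2` survives only through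
  -- the derivative of the sine.
  simp only [Pi.mul_apply, Pi.add_apply, e1, e2, e3, e4, Complex.cos_pi, Complex.sin_pi] at h3
  refine mul_right_cancel₀ (b := (-1 : ℂ)) (by norm_num) ?_
  rw [h3]
  field_simp
  ring

/-! ### Taylor remainders of `(κ + t) ^ (-s)`. -/

lemma norm_le_mul_pow_succ_of_norm_deriv_le {f f' : ℝ → ℂ} {M : ℝ} {n : ℕ} (h0 : f 0 = 0)
    (hf : ∀ x ∈ Set.Icc (0 : ℝ) 1, HasDerivAt f (f' x) x)
    (hb : ∀ x ∈ Set.Icc (0 : ℝ) 1, ‖f' x‖ ≤ (n + 1) * M * x ^ n) :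
    ∀ x ∈ Set.Icc (0 : ℝ) 1, ‖f x‖ ≤ M * x ^ (n + 1) := by
  intro x hx
  refine image_norm_le_of_norm_deriv_right_le_deriv_boundary (f := f) (f' := f') (a := 0) (b := 1)
    (B := fun x => M * x ^ (n + 1)) (B' := fun x => (n + 1) * M * x ^ n)
    (fun y hy => (hf y hy).continuousAt.continuousWithinAt)
    (fun y hy => (hf y ⟨hy.1, hy.2.le⟩).hasDerivWithinAt) (by simp [h0]) (fun y => ?_)
    (fun y hy => hb y ⟨hy.1, hy.2.le⟩) hx
  refine ((hasDerivAt_pow (n + 1) y).const_mul M).congr_deriv ?_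
  push_cast
  ring

lemma hasDerivAt_add_ofReal_cpow {κ x : ℝ} (h : 0 < κ + x) (c : ℂ) :
    HasDerivAt (fun x : ℝ => (κ + x : ℂ) ^ c) (c * (κ + x : ℂ) ^ (c - 1)) x := by
  have : HasDerivAt (fun z : ℂ => (κ + z) ^ c) (c * (κ + x : ℂ) ^ (c - 1)) (x : ℂ) := by
    simpa using ((hasDerivAt_id (x : ℂ)).const_add (κ : ℂ)).cpow_const (c := c)
      (by rw [id, ← ofReal_add]; exact ofReal_mem_slitPlane.mpr h)
  exact this.comp_ofReal

/-- The remainder of the second order Taylor expansion of `(κ + t) ^ (-s)` at `t = 0`. -/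
noncomputable def cpowTaylorRemainder (t κ : ℝ) (s : ℂ) : ℂ :=
  (κ + t : ℂ) ^ (-s) - (κ : ℂ) ^ (-s) + s * t * (κ : ℂ) ^ (-s - 1)
    - s * (s + 1) / 2 * t ^ 2 * (κ : ℂ) ^ (-s - 2)

/-- The third derivative in `t` is integrated three times from `0`. Its exponent `-s - 3` has real
part below `-3/2`, which makes the bound summable over `κ = n + 1`. -/
lemma norm_cpowTaylorRemainder_le {κ t : ℝ} {s : ℂ} (hκ : 1 ≤ κ) (ht : t ∈ Set.Icc (0 : ℝ) 1)
    (hs : -(3 / 2) < s.re) (hs' : ‖s‖ < 4) :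
    ‖cpowTaylorRemainder t κ s‖ ≤ 20 * κ ^ (-(3 / 2) : ℝ) := by
  have hκ0 : 0 < κ := by linarith
  have hpos : ∀ x ∈ Set.Icc (0 : ℝ) 1, 0 < κ + x := fun x hx => by linarith [hx.1]
  set M : ℝ := 20 * κ ^ (-(3 / 2) : ℝ) with hM
  let f₂ : ℝ → ℂ := fun x => s * (s + 1) * ((κ + x : ℂ) ^ (-s - 2) - (κ : ℂ) ^ (-s - 2))
  let f₁ : ℝ → ℂ := fun x => -s * ((κ + x : ℂ) ^ (-s - 1) - (κ : ℂ) ^ (-s - 1))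
    - s * (s + 1) * x * (κ : ℂ) ^ (-s - 2)
  have hx1 : ∀ x : ℝ, HasDerivAt (fun x : ℝ => (x : ℂ)) 1 x := fun x => hasDerivAt_id' x |>.ofReal_comp
  have b2 : ∀ x ∈ Set.Icc (0 : ℝ) 1, ‖f₂ x‖ ≤ 6 * M * x ^ (0 + 1) := by
    refine norm_le_mul_pow_succ_of_norm_deriv_le
      (f' := fun x => s * (s + 1) * ((-s - 2) * (κ + x : ℂ) ^ (-s - 2 - 1))) (by simp [f₂])
      (fun x hx => ?_) (fun x hx => ?_)
    · exact ((hasDerivAt_add_ofReal_cpow (hpos x hx) _).sub_const _).const_mul _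
    · rw [norm_mul, norm_mul, norm_mul, ← ofReal_add, norm_cpow_eq_rpow_re_of_pos (hpos x hx)]
      have n1 : ‖s + 1‖ ≤ 5 := (norm_add_le _ _).trans (by rw [norm_one]; linarith)
      have n2 : ‖-s - 2‖ ≤ 6 := (norm_sub_le _ _).trans (by rw [norm_neg, norm_ofNat]; linarith)
      have n3 : (κ + x) ^ (-s - 2 - 1).re ≤ κ ^ (-(3 / 2) : ℝ) := by
        calc (κ + x) ^ (-s - 2 - 1).re ≤ (κ + x) ^ (-(3 / 2) : ℝ) := by
              refine Real.rpow_le_rpow_of_exponent_le (by linarith [hx.1]) ?_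
              simp
              linarith
          _ ≤ κ ^ (-(3 / 2) : ℝ) :=
              Real.rpow_le_rpow_of_nonpos hκ0 (by linarith [hx.1]) (by norm_num)
      -- Here `4 * 5 * 6 = 6 * 20`; the three integrations divide by `1`, `2` and `3`, leaving the
      -- constant `20`.
      calc ‖s‖ * ‖s + 1‖ * (‖-s - 2‖ * (κ + x) ^ (-s - 2 - 1).re)
          ≤ 4 * 5 * (6 * κ ^ (-(3 / 2) : ℝ)) := by
            have := Real.rpow_nonneg (hpos x hx).le (-s - 2 - 1).re
            gcongr
        _ = ((0 : ℕ) + 1) * (6 * M) * x ^ 0 := by rw [hM]; push_cast; ring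
  have b1 : ∀ x ∈ Set.Icc (0 : ℝ) 1, ‖f₁ x‖ ≤ 3 * M * x ^ (1 + 1) := by
    refine norm_le_mul_pow_succ_of_norm_deriv_le (f' := f₂) (by simp [f₁])
      (fun x hx => ?_) (fun x hx => ?_)
    · have h := (((hasDerivAt_add_ofReal_cpow (hpos x hx) (-s - 1)).sub_const
        ((κ : ℂ) ^ (-s - 1))).const_mul (-s)).sub
        (((hx1 x).const_mul (s * (s + 1))).mul_const ((κ : ℂ) ^ (-s - 2)))
      refine HasDerivAt.congr_deriv h ?_
      simp only [f₂]
      rw [show -s - 1 - 1 = -s - 2 by ring]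
      ring
    · convert b2 x hx using 1
      push_cast; ring
  have b0 := norm_le_mul_pow_succ_of_norm_deriv_le (f := fun x => cpowTaylorRemainder x κ s)
    (f' := f₁) (M := M) (n := 2) (by simp [cpowTaylorRemainder])
    (fun x hx => ?_) (fun x hx => ?_) t ht
  · refine b0.trans ?_
    have : 0 ≤ M := by positivity
    exact mul_le_of_le_one_right this (pow_le_one₀ ht.1 ht.2)
  · have h := (((hasDerivAt_add_ofReal_cpow (hpos x hx) (-s)).sub_const
        ((κ : ℂ) ^ (-s))).add (((hx1 x).const_mul s).mul_const ((κ : ℂ) ^ (-s - 1)))).sub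
        ((((hx1 x).pow 2).const_mul (s * (s + 1) / 2)).mul_const ((κ : ℂ) ^ (-s - 2)))
    refine HasDerivAt.congr_deriv h ?_
    simp only [f₁]
    push_cast
    ring
  · convert b1 x hx using 1
    push_cast; ring

lemma differentiable_cpowTaylorRemainder {κ t : ℝ} (hκ : 0 < κ) (ht : 0 ≤ t) :
    Differentiable ℂ (cpowTaylorRemainder t κ) := by
  have h1 : (κ : ℂ) ≠ 0 := by exact_mod_cast hκ.ne'
  have h2 : (κ + t : ℂ) ≠ 0 := by exact_mod_cast (by positivity : κ + t ≠ 0)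
  have c1 : ∀ {b : ℂ} {g : ℂ → ℂ}, b ≠ 0 → Differentiable ℂ g →
      Differentiable ℂ fun s => b ^ g s := fun hb hg => hg.const_cpow (Or.inl hb)
  unfold cpowTaylorRemainder
  exact (((c1 h2 (by fun_prop)).sub (c1 h1 (by fun_prop))).add
    (Differentiable.mul (by fun_prop) (c1 h1 (by fun_prop)))).sub
    (Differentiable.mul (by fun_prop) (c1 h1 (by fun_prop)))

lemma deriv_cpowTaylorRemainder_neg_one {κ t : ℝ} (hκ : 0 < κ) (ht : 0 ≤ t) :
    deriv (cpowTaylorRemainder t κ) (-1) =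
      ((-(κ + t) * Real.log (1 + t / κ) + t + t ^ 2 / (2 * κ) : ℝ) : ℂ) := by
  have h1 : (κ : ℂ) ≠ 0 := by exact_mod_cast hκ.ne'
  have hpos : 0 < κ + t := by positivity
  have h2 : (κ + t : ℂ) ≠ 0 := by exact_mod_cast hpos.ne'
  have d := hasDerivAt_neg (-1 : ℂ)
  have hid := hasDerivAt_id (-1 : ℂ)
  have h := (((d.const_cpow (c := (κ + t : ℂ)) (Or.inl h2)).sub
      (d.const_cpow (c := (κ : ℂ)) (Or.inl h1))).add
      ((hid.mul_const (t : ℂ)).mul ((d.sub_const 1).const_cpow (c := (κ : ℂ)) (Or.inl h1)))).sub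
      ((((hid.mul (hid.add_const 1)).div_const 2).mul_const ((t : ℂ) ^ 2)).mul
        ((d.sub_const 2).const_cpow (c := (κ : ℂ)) (Or.inl h1)))
  have h' : HasDerivAt (cpowTaylorRemainder t κ) _ (-1) := h
  rw [h'.deriv]
  have e : Real.log (1 + t / κ) = Real.log (κ + t) - Real.log κ := by
    rw [← Real.log_div hpos.ne' hκ.ne']; congr 1; field_simp
  have e1 : Complex.log (κ + t) = (Real.log (κ + t) : ℝ) := by
    rw [Complex.ofReal_log hpos.le]; push_cast; rfl
  have e2 : (κ : ℂ) ^ (1 - 2 : ℂ) = (κ : ℂ)⁻¹ := by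
    rw [show (1 - 2 : ℂ) = -1 by norm_num, cpow_neg_one]
  rw [e]
  simp only [id, neg_neg, sub_self, cpow_one, cpow_zero, e1, e2, neg_add_cancel, mul_zero,
    zero_mul, zero_div, Pi.mul_apply]
  rw [← Complex.ofReal_log hκ.le]
  push_cast
  field_simp
  ring

/-! ### Summing the remainders: analytic continuation to `s = -1`. -/

lemma hasSum_one_div_nat_add_one_cpow {s : ℂ} (hs : 1 < s.re) :
    HasSum (fun n : ℕ => 1 / (n + 1 : ℂ) ^ s) (riemannZeta s) := by
  have h := hasSum_hurwitzZeta_of_one_lt_re (a := 1) (by simp) hs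
  rw [AddCircle.coe_period, hurwitzZeta_zero] at h
  simpa using h

/-- The Taylor coefficients supply the factors `s` and `s + 1` that cancel the poles of `ζ(s+1)` and
`ζ(s+2)`. Writing the result with `riemannZeta₁`, that is `(s - 1) ζ(s)`, keeps it meaningful at `s
= -1`. The term `t ^ (-s)` is the `n = 0` term of the Hurwitz series. -/
lemma hasSum_cpowTaylorRemainder {t : ℝ} (ht : t ∈ Set.Icc (0 : ℝ) 1) {s : ℂ} (hs : 1 < s.re) :
    HasSum (fun n : ℕ => cpowTaylorRemainder t (n + 1) s)
      (hurwitzZeta t s - riemannZeta s - ((t : ℂ) ^ (-s) - t * riemannZeta₁ (s + 1)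
        + s * t ^ 2 / 2 * riemannZeta₁ (s + 2))) := by
  have hs0 : s ≠ 0 := by rintro rfl; simp at hs; linarith
  have hs1 : s + 1 ≠ 0 := fun h => by
    have := congrArg re h; simp at this; linarith
  have h0 := (hasSum_nat_add_iff' 1).mpr (hasSum_hurwitzZeta_of_one_lt_re ht hs)
  have h1 := hasSum_one_div_nat_add_one_cpow (s := s + 1) (by simp; linarith)
  have h2 := hasSum_one_div_nat_add_one_cpow (s := s + 2) (by simp; linarith)
  have h := ((h0.sub (hasSum_one_div_nat_add_one_cpow hs)).add (h1.mul_left (s * t))).sub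
    (h2.mul_left (s * (s + 1) / 2 * t ^ 2))
  have e : hurwitzZeta t s - riemannZeta s - ((t : ℂ) ^ (-s) - t * riemannZeta₁ (s + 1)
        + s * t ^ 2 / 2 * riemannZeta₁ (s + 2)) =
      hurwitzZeta t s - ∑ i ∈ Finset.range 1, 1 / ((i : ℂ) + t) ^ s - riemannZeta s
        + s * t * riemannZeta (s + 1) - s * (s + 1) / 2 * t ^ 2 * riemannZeta (s + 2) := by
    rw [riemannZeta_eq_inv_sub_mul (s := s + 1) (by simpa using hs0),
      riemannZeta_eq_inv_sub_mul (s := s + 2) (fun h => hs1 (by linear_combination h))]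
    simp only [Finset.range_one, Finset.sum_singleton, Nat.cast_zero, zero_add, cpow_neg,
      add_sub_cancel_right]
    rw [show s + 2 - 1 = s + 1 by ring]
    field_simp
    ring
  rw [e]
  refine h.congr_fun fun n => ?_
  simp only [cpowTaylorRemainder]
  push_cast
  rw [cpow_neg, cpow_neg, show -s - 1 = -(s + 1) by ring, show -s - 2 = -(s + 2) by ring,
    cpow_neg, cpow_neg]
  ring

/-- A convex open set containing `-1` and some points with real part larger than one. -/
def zetaRegion : Set ℂ := {s | -(3 / 2) < s.re} ∩ Metric.ball 0 4

lemma isOpen_zetaRegion : IsOpen zetaRegion :=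
  (isOpen_lt continuous_const continuous_re).inter Metric.isOpen_ball

lemma isPreconnected_zetaRegion : IsPreconnected zetaRegion :=
  ((convex_halfSpace_re_gt _).inter (convex_ball 0 4)).isPreconnected

lemma neg_one_mem_zetaRegion : (-1 : ℂ) ∈ zetaRegion := by
  refine ⟨?_, by simp⟩
  simp
  norm_num

lemma two_mem_zetaRegion : (2 : ℂ) ∈ zetaRegion := by
  constructor <;> simp <;> norm_num

lemma summable_remainder_bound :
    Summable fun n : ℕ => 20 * ((n : ℝ) + 1) ^ (-(3 / 2) : ℝ) := by
  refine Summable.mul_left _ ?_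
  have := (summable_nat_add_iff 1).mpr
    (Real.summable_nat_rpow (p := (-(3 / 2) : ℝ)).mpr (by norm_num))
  simpa using this

lemma norm_cpowTaylorRemainder_le_of_mem {t : ℝ} (ht : t ∈ Set.Icc (0 : ℝ) 1) (n : ℕ) (s : ℂ)
    (hs : s ∈ zetaRegion) :
    ‖cpowTaylorRemainder t (n + 1) s‖ ≤ 20 * ((n : ℝ) + 1) ^ (-(3 / 2) : ℝ) :=
  norm_cpowTaylorRemainder_le (by linarith [(Nat.cast_nonneg n : (0 : ℝ) ≤ n)]) ht hs.1
    (by simpa using hs.2)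

lemma differentiableOn_cpowTaylorRemainder {t : ℝ} (ht : 0 ≤ t) (n : ℕ) :
    DifferentiableOn ℂ (cpowTaylorRemainder t (n + 1)) zetaRegion :=
  (differentiable_cpowTaylorRemainder (by positivity) ht).differentiableOn

lemma differentiableOn_tsum_cpowTaylorRemainder {t : ℝ} (ht : t ∈ Set.Icc (0 : ℝ) 1) :
    DifferentiableOn ℂ (fun s => ∑' n : ℕ, cpowTaylorRemainder t (n + 1) s) zetaRegion :=
  differentiableOn_tsum_of_summable_norm summable_remainder_bound
    (differentiableOn_cpowTaylorRemainder ht.1) isOpen_zetaRegion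
    (norm_cpowTaylorRemainder_le_of_mem ht)

/-- Identity theorem: both sides are analytic on the connected region and agree near `2`, where the
Dirichlet series converge. -/
lemma tsum_cpowTaylorRemainder_eqOn {t : ℝ} (ht0 : 0 < t) (ht1 : t ≤ 1) :
    Set.EqOn (fun s => ∑' n : ℕ, cpowTaylorRemainder t (n + 1) s)
      (fun s => hurwitzZeta t s - riemannZeta s - ((t : ℂ) ^ (-s) - t * riemannZeta₁ (s + 1)
        + s * t ^ 2 / 2 * riemannZeta₁ (s + 2))) zetaRegion := by
  have ht : t ∈ Set.Icc (0 : ℝ) 1 := ⟨ht0.le, ht1⟩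
  have htc : (t : ℂ) ≠ 0 := by exact_mod_cast ht0.ne'
  have hd : Differentiable ℂ fun s => hurwitzZeta t s - riemannZeta s := by
    rw [← hurwitzZeta_zero]
    exact differentiable_hurwitzZeta_sub_hurwitzZeta _ _
  have hp : Differentiable ℂ fun s : ℂ => (t : ℂ) ^ (-s) :=
    Differentiable.const_cpow (by fun_prop) (Or.inl htc)
  have hR : Differentiable ℂ fun s => hurwitzZeta t s - riemannZeta s - ((t : ℂ) ^ (-s)
      - t * riemannZeta₁ (s + 1) + s * t ^ 2 / 2 * riemannZeta₁ (s + 2)) := by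
    fun_prop
  refine AnalyticOnNhd.eqOn_of_preconnected_of_eventuallyEq (z₀ := 2)
    ((differentiableOn_tsum_cpowTaylorRemainder ht).analyticOnNhd isOpen_zetaRegion)
    (hR.differentiableOn.analyticOnNhd isOpen_zetaRegion) isPreconnected_zetaRegion
    two_mem_zetaRegion ?_
  filter_upwards [(isOpen_lt continuous_const continuous_re).mem_nhds
    (show (1 : ℝ) < (2 : ℂ).re by simp)] with s hs
  exact (hasSum_cpowTaylorRemainder ht hs).tsum_eq

lemma riemannZeta₁_zero : riemannZeta₁ 0 = 1 / 2 := by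
  have h := riemannZeta_eq_inv_sub_mul (s := 0) (by norm_num)
  rw [riemannZeta_zero] at h
  norm_num at h
  linear_combination -h

lemma deriv_riemannZeta₁_zero : deriv riemannZeta₁ 0 = (Real.log (2 * Real.pi) - 1) / 2 := by
  have h := deriv_riemannZeta_eq_neg_inv_sub_sq_mul_add (s := 0) (by norm_num)
  rw [deriv_riemannZeta_zero, riemannZeta₁_zero] at h
  have e2 : Complex.log (2 * Real.pi) = (Real.log (2 * Real.pi) : ℝ) := by
    rw [Complex.ofReal_log (by positivity)]; push_cast; rfl
  rw [e2] at h
  norm_num at h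
  linear_combination h

theorem deriv_tsum_cpowTaylorRemainder {t : ℝ} (ht0 : 0 < t) (ht1 : t ≤ 1) :
    deriv (fun s => ∑' n : ℕ, cpowTaylorRemainder t (n + 1) s) (-1) =
      deriv (hurwitzZeta t) (-1) - deriv riemannZeta (-1) + t * Real.log t
        + t * (Real.log (2 * Real.pi) - 1) / 2
        + t ^ 2 / 2 * (Real.eulerMascheroniConstant - 1) := by
  have htc : (t : ℂ) ≠ 0 := by exact_mod_cast ht0.ne'
  rw [((tsum_cpowTaylorRemainder_eqOn ht0 ht1).eventuallyEq_of_mem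
    (isOpen_zetaRegion.mem_nhds neg_one_mem_zetaRegion)).deriv_eq]
  have hH := (differentiableAt_hurwitzZeta (t : UnitAddCircle)
    (s := -1) (by norm_num)).hasDerivAt
  have hZ := (differentiableAt_riemannZeta (s := -1) (by norm_num)).hasDerivAt
  have hP := (hasDerivAt_neg (-1 : ℂ)).const_cpow (c := (t : ℂ)) (Or.inl htc)
  have hid := hasDerivAt_id (-1 : ℂ)
  have h1 : HasDerivAt (fun s => riemannZeta₁ (s + 1)) (deriv riemannZeta₁ 0) (-1) := by
    have := (differentiable_riemannZeta₁ (-1 + 1)).hasDerivAt.comp_add_const (-1) 1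
    simpa using this
  have h2 : HasDerivAt (fun s => riemannZeta₁ (s + 2)) (deriv riemannZeta₁ 1) (-1) := by
    have := (differentiable_riemannZeta₁ (-1 + 2)).hasDerivAt.comp_add_const (-1) 2
    rwa [show (-1 + 2 : ℂ) = 1 by norm_num] at this
  have h := (hH.sub hZ).sub ((hP.sub (h1.const_mul (t : ℂ))).add
    (((hid.mul_const ((t : ℂ) ^ 2)).div_const 2).mul h2))
  have h' : HasDerivAt (fun s => hurwitzZeta t s - riemannZeta s - ((t : ℂ) ^ (-s)
    - t * riemannZeta₁ (s + 1) + s * t ^ 2 / 2 * riemannZeta₁ (s + 2))) _ (-1) := h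
  rw [h'.deriv, deriv_riemannZeta₁_zero, deriv_riemannZeta₁_one,
    show (-1 + 2 : ℂ) = 1 by norm_num, riemannZeta₁_one]
  simp only [id, neg_neg, cpow_one]
  rw [← Complex.ofReal_log ht0.le]
  ring

/-! ### The Weierstrass products of `Γ` and `G`. -/

lemma hasSum_div_sub_log_one_add_div {t : ℝ} (ht : 0 < t) :
    HasSum (fun n : ℕ => t / (n + 1 : ℝ) - Real.log (1 + t / (n + 1 : ℝ)))
      (Real.log (Real.Gamma t) + Real.log t + Real.eulerMascheroniConstant * t) := by
  -- As `log (1 + x) ≤ x`, the terms are nonnegative and the limit of partial sums suffices. These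
  -- combine Gauss's limit for `log Γ` with `H_N - log N → γ`; the `log N` terms cancel.
  rw [hasSum_iff_tendsto_nat_of_nonneg (fun n => by
    have h : (0 : ℝ) < 1 + t / (n + 1) := by positivity
    linarith [Real.log_le_sub_one_of_pos h])]
  have h := ((Real.BohrMollerup.tendsto_log_gamma ht).add_const (Real.log t)).add
    (Real.tendsto_eulerMascheroniSeq'.mul_const t)
  refine h.congr' ?_
  filter_upwards [eventually_ne_atTop 0] with N hN
  have e : ∀ n : ℕ, Real.log (1 + t / (n + 1 : ℝ)) =
      Real.log (t + ((n + 1 : ℕ) : ℝ)) - Real.log ((n + 1 : ℕ) : ℝ) := fun n => by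
    rw [← Real.log_div (by positivity) (by positivity)]
    congr 1
    push_cast
    field_simp
    ring
  have hfac : Real.log (N.factorial : ℝ) = ∑ n ∈ Finset.range N, Real.log ((n + 1 : ℕ) : ℝ) := by
    rw [← Finset.prod_range_add_one_eq_factorial, Nat.cast_prod, Real.log_prod]
    intro n _
    positivity
  have hharm : ∑ n ∈ Finset.range N, t / (n + 1 : ℝ) = (harmonic N : ℝ) * t := by
    rw [harmonic]
    push_cast
    rw [Finset.sum_mul]
    refine Finset.sum_congr rfl fun n _ => ?_
    ring
  simp_rw [e]
  rw [Finset.sum_sub_distrib, Finset.sum_sub_distrib, hharm, ← hfac,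
    Real.BohrMollerup.logGammaSeq, Real.eulerMascheroniSeq', if_neg hN, Finset.sum_range_succ']
  push_cast
  ring_nf

lemma barnesGFactor_pos {t : ℝ} (ht : 0 ≤ t) (k : ℕ) : 0 < barnesGFactor t k := by
  unfold barnesGFactor
  positivity

lemma log_barnesGFactor {t : ℝ} (ht : 0 ≤ t) (k : ℕ) :
    Real.log (barnesGFactor t k) = k * Real.log (1 + t / k) + (t ^ 2 / (2 * k) - t) := by
  have h : 0 < 1 + t / (k : ℝ) := by positivity
  rw [barnesGFactor, Real.log_mul (by positivity) (Real.exp_ne_zero _), Real.log_pow,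
    Real.log_exp]

lemma exists_hasSum_log_barnesGFactor {t : ℝ} (ht0 : 0 < t) (ht1 : t ≤ 1) :
    ∃ L : ℝ, HasSum (fun n : ℕ => Real.log (barnesGFactor t (n + 1))) L ∧
      (L : ℂ) = t * ((Real.log (Real.Gamma t) + Real.log t + Real.eulerMascheroniConstant * t : ℝ))
        - deriv (fun s => ∑' n : ℕ, cpowTaylorRemainder t (n + 1) s) (-1) := by
  have ht : t ∈ Set.Icc (0 : ℝ) 1 := ⟨ht0.le, ht1⟩
  have h := hasSum_deriv_of_summable_norm summable_remainder_bound
    (differentiableOn_cpowTaylorRemainder ht.1) isOpen_zetaRegion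
    (norm_cpowTaylorRemainder_le_of_mem ht) neg_one_mem_zetaRegion
  have e : ∀ n : ℕ, deriv (cpowTaylorRemainder t (n + 1)) (-1) = _ :=
    fun n => deriv_cpowTaylorRemainder_neg_one (by positivity) ht0.le
  simp_rw [e] at h
  obtain ⟨R, hR⟩ := Complex.summable_ofReal.mp h.summable
  -- With `κ = n + 1`, the log of the factor is `t (t/κ - log (1 + t/κ))` minus the derivative of
  -- the remainder at `-1`.
  refine ⟨_, (((hasSum_div_sub_log_one_add_div ht0).mul_left t).sub hR).congr_fun fun n => ?_, ?_⟩
  · rw [log_barnesGFactor ht0.le]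
    push_cast
    field_simp
    ring
  · rw [h.unique (Complex.hasSum_ofReal.mpr hR)]
    push_cast
    ring

lemma barnesGFactor_zero (k : ℕ) : barnesGFactor 0 k = 1 := by simp [barnesGFactor]

lemma barnesG_one : barnesG 1 = 1 := by simp [barnesG, barnesGFactor_zero]

/-- The Weierstrass product of the Barnes `G`-function converges on `[0, 1]`, and the logarithm of
the function is a value of the derivative of the Hurwitz zeta function. -/
theorem log_barnesG_eq_deriv_hurwitzZeta {t : ℝ} (ht0 : 0 ≤ t) (ht1 : t ≤ 1) :
    Multipliable (fun k : ℕ => barnesGFactor t (k + 1)) ∧ 0 < barnesG (1 + t) ∧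
      ((Real.log (barnesG (1 + t)) : ℝ) : ℂ) = t * Real.log (Real.Gamma t)
        - deriv (hurwitzZeta t) (-1) + deriv riemannZeta (-1) := by
  rcases ht0.eq_or_lt with rfl | ht0
  -- At `t = 0` the product is trivial and the Hurwitz zeta function is `ζ`, so the two derivatives
  -- cancel.
  · simp [barnesGFactor_zero, barnesG_one, multipliable_one, hurwitzZeta_zero]
  obtain ⟨L, hL, hLeq⟩ := exists_hasSum_log_barnesGFactor ht0 ht1
  have hprod : HasProd (fun k : ℕ => barnesGFactor t (k + 1)) (Real.exp L) := by
    refine hL.rexp.congr_fun fun k => ?_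
    simp [Real.exp_log (barnesGFactor_pos ht0.le (k + 1))]
  have hG : barnesG (1 + t) = (2 * Real.pi) ^ (t / 2) * Real.exp (-(1 / 2) *
      (Real.eulerMascheroniConstant * t ^ 2 + t ^ 2 + t)) * Real.exp L := by
    rw [barnesG, add_sub_cancel_left, hprod.tprod_eq]
  have h2pi : 0 < 2 * Real.pi := Real.two_pi_pos
  refine ⟨hprod.multipliable, by rw [hG]; positivity, ?_⟩
  rw [hG, Real.log_mul (by positivity) (by positivity), Real.log_mul (by positivity) (by positivity),
    Real.log_rpow h2pi, Real.log_exp, Real.log_exp, Complex.ofReal_add, hLeq,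
    deriv_tsum_cpowTaylorRemainder ht0 ht1]
  push_cast
  ring

/-! ### The limit at zero and the final formula. -/

lemma tendsto_mul_log_Gamma_zero :
    Tendsto (fun t : ℝ => t * Real.log (Real.Gamma t)) (𝓝[>] 0) (𝓝 0) := by
  have h1 : ContinuousAt (fun t : ℝ => t * Real.log (Real.Gamma (t + 1)) - t * Real.log t) 0 := by
    refine (continuousAt_id.mul (ContinuousAt.log
      (ContinuousAt.comp (g := Real.Gamma) (f := fun t => t + 1) ?_ (by fun_prop)) ?_)).sub
      Real.continuous_mul_log.continuousAt
    · refine (Real.differentiableAt_Gamma fun m => ?_).continuousAt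
      have := (Nat.cast_nonneg m : (0 : ℝ) ≤ m)
      linarith
    · simp
  have h2 := h1.tendsto.mono_left (nhdsWithin_le_nhds (s := Set.Ioi 0))
  simp only [zero_mul, sub_self] at h2
  refine h2.congr' ?_
  filter_upwards [self_mem_nhdsWithin] with t ht
  have ht' : 0 < t := ht
  rw [Real.Gamma_add_one ht'.ne', Real.log_mul ht'.ne' (Real.Gamma_pos_of_pos ht').ne']
  ring

lemma cosZeta_two_eq_bernoulliFun {t : ℝ} (ht : t ∈ Set.Icc (0 : ℝ) 1) :
    cosZeta t 2 = Real.pi ^ 2 * bernoulliFun 2 t := by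
  have h := cosZeta_two_mul_nat (k := 1) one_ne_zero ht
  rw [Polynomial.eval_map_algebraMap, ← Complex.coe_algebraMap,
    Polynomial.aeval_algebraMap_apply, ← Polynomial.eval_map_algebraMap] at h
  change _ = _ * ((bernoulliFun 2 t : ℝ) : ℂ) at h
  norm_num at h
  rw [h, bernoulliFun_two]
  push_cast
  ring

theorem mainTheorem1 :
    (∀ t : ℝ, 0 ≤ t → t ≤ 1 →
      Multipliable (fun k : ℕ => barnesGFactor t (k + 1)) ∧
      0 < barnesG (1 + t) ∧
      Summable (fun n : ℕ => Real.sin (2 * (n + 1 : ℝ) * Real.pi * t) / (n + 1 : ℝ) ^ 2) ∧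
      Summable (fun n : ℕ => Real.cos (2 * (n + 1 : ℝ) * Real.pi * t) / (n + 1 : ℝ) ^ 2) ∧
      Summable (fun n : ℕ =>
        Real.cos (2 * (n + 1 : ℝ) * Real.pi * t) * Real.log (n + 1 : ℝ) / (n + 1 : ℝ) ^ 2) ∧
      ((Real.log (barnesG (1 + t)) : ℝ) : ℂ) =
        ((-(1 / (4 * Real.pi)) *
              (∑' n : ℕ, Real.sin (2 * (n + 1 : ℝ) * Real.pi * t) / (n + 1 : ℝ) ^ 2)
            + 1 / (2 * Real.pi ^ 2) *
              (Real.log (2 * Real.pi) + Real.eulerMascheroniConstant - 3 / 2) *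
              (∑' n : ℕ, Real.cos (2 * (n + 1 : ℝ) * Real.pi * t) / (n + 1 : ℝ) ^ 2)
            + 1 / (2 * Real.pi ^ 2) *
              (∑' n : ℕ, Real.cos (2 * (n + 1 : ℝ) * Real.pi * t) * Real.log (n + 1 : ℝ) /
                (n + 1 : ℝ) ^ 2)
            + t * Real.log (Real.Gamma t)
            + 1 / 4 * bernoulliFun 2 t : ℝ) : ℂ)
          + deriv riemannZeta (-1)) ∧
    Filter.Tendsto (fun t : ℝ => t * Real.log (Real.Gamma t))
      (nhdsWithin 0 (Set.Ioi 0)) (nhds 0) := by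
  refine ⟨fun t ht0 ht1 => ?_, tendsto_mul_log_Gamma_zero⟩
  obtain ⟨hm, hpos, hlog⟩ := log_barnesG_eq_deriv_hurwitzZeta ht0 ht1
  have hS := hasSum_sin_div_sq t
  have hC := hasSum_cos_div_sq t
  have hL := hasSum_log_mul_cos_div_sq t
  refine ⟨hm, hpos, Complex.summable_ofReal.mp hS.summable, Complex.summable_ofReal.mp hC.summable,
    Complex.summable_ofReal.mp hL.summable, ?_⟩
  rw [hlog, deriv_hurwitzZeta_neg_one]
  simp only [Complex.ofReal_add, Complex.ofReal_mul, Complex.ofReal_tsum, hS.tsum_eq, hC.tsum_eq,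
    hL.tsum_eq]
  -- The term `B₂(t)/4` equals `1/(2π²) * 1/2` times the cosine series, which reconciles the
  -- constant `-3/2` with the `-1` from Hurwitz's formula.
  have hB := cosZeta_two_eq_bernoulliFun ⟨ht0, ht1⟩
  have hB' : ((bernoulliFun 2 t : ℝ) : ℂ) = cosZeta t 2 / Real.pi ^ 2 := by
    have : (Real.pi : ℂ) ≠ 0 := by exact_mod_cast Real.pi_ne_zero
    rw [hB]; field_simp
  rw [hB']
  push_cast
  ring
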